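/- Let $X=(X(t))_{t\in[0,1]}$ be a (jointly measurable) centered real second-order process with trajectories in $L^2[0,1]$ whose covariance function $K(t,s)=\mathbb E[X(t)X(s)]$ is continuous and strictly positive definite (all Gram matrices $(K(t_i,t_j))_{i,j}$ at distinct points are positive definite). Fix $p\in\mathbb N$ and let $$\Theta_p=\{\theta=(b,\tau,\alpha_0,\sigma^2):\ b=(\beta_1,\dots,\beta_p)\in\mathbb R^p,\ \tau=(t_1,\dots,t_p)\in[0,1]^p,\ \alpha_0\in\mathbb R,\ \sigma^2\in[0,\infty)\}$$ with the metric $d(\theta,\theta')=\min\{\|\theta-\theta'\|,1\}$, where $\|\cdot\|$ is the Euclidean norm of $\mathbb R^{2p+2}$, and its Borel sigma-algebra. For $\theta\in\Theta_p$ let $P_\theta$ be the law on $L^2[0,1]\times\mathbb R$ of $(X,Y)$, where $Y=\alpha_0+\sum_{j=1}^p\beta_jX(t_j)+e$ and $e\sim\mathcal N(0,\sigma^2)$ is independent of $X$. Let $\Pi$ be a prior probability measure on $\Theta_p$ (for example $F\otimes G\otimes C\otimes D$ with $b\sim F$, $\tau\sim G$, $\alpha_0\sim C$, $\sigma^2\sim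 D$), and consider the model in which $\boldsymbol\theta\sim\Pi$ and, given $\boldsymbol\theta$, the observations $(X_1,Y_1),(X_2,Y_2),\dots$ are i.i.d. with law $P_{\boldsymbol\theta}$. For every $n$ let $\Pi(\boldsymbol\theta\in\cdot\mid (X,Y)_{1:n})$ be a regular conditional distribution of $\boldsymbol\theta$ given the first $n$ observations in this model (any version). For a permutation $\nu$ of $\{1,\dots,p\}$ let $\theta[\nu]$ be obtained from $\theta$ by applying $\nu$ to the component labels of $b$ and $\tau$, and let $\tilde B(\theta_0,\epsilon)=\bigcup_\nu\{\theta\in\Theta_p: d(\theta,\theta_0[\nu])<\epsilon\}$. Let $\tilde B^{*}(\theta_0,\epsilon)\supseteq\tilde B(\theta_0,\epsilon)$ be defined in the same way, except that in the distance from $\theta$ to $\theta_0[\nu]$ the times of those components whose coefficient in $\theta_0[\nu]$ is zero are disregarded; thus $\tilde B^*(\theta_0,\epsilon)=\tilde B(\theta_0,\epsilon)$ if all coefficients of $\theta_0$ are nonzero. Assume that $\Pi(t_i=t_j)=0$ for all $1\le i<j\le p$. Then, for $\Pi$-almost every $\theta_0\in\Theta_p$, if the data are i.i.d. with law $P_{\theta_0}$: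 1. if all coefficients $\beta_j$ of $\theta_0$ are nonzero, the posterior is consistent at $\theta_0$ up to relabelling of the components: for every $\epsilon>0$, $$\lim_{n\to\infty}\Pi\big(\boldsymbol\theta\in\tilde B(\theta_0,\epsilon)\mid (X,Y)_{1:n}\big)=1\qquad P_{\theta_0}^\infty\text{-a.s.};$$ 2. without restriction on the coefficients of $\theta_0$, for every $\epsilon>0$, $$\lim_{n\to\infty}\Pi\big(\boldsymbol\theta\in\tilde B^*(\theta_0,\epsilon)\mid (X,Y)_{1:n}\big)=1\qquad P_{\theta_0}^\infty\text{-a.s.}$$ In particular, if the prior gives probability zero to each event $\{\beta_j=0\}$ (for instance if the coefficients have a continuous prior distribution), the posterior is consistent up to relabelling at $\Pi$-almost every $\theta_0$. -/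

import Mathlib

open MeasureTheory ProbabilityTheory Filter Topology
open scoped NNReal ENNReal

noncomputable section

namespace FunctionalRegression

/-- The Hilbert space `L²[0,1]` (classes of functions on `[0,1]` with Lebesgue measure). -/
abbrev L2I : Type := Lp ℝ 2 (volume : Measure unitInterval)

instance instMeasurableSpaceL2I : MeasurableSpace L2I := borel L2I

instance instBorelSpaceL2I : BorelSpace L2I := ⟨rfl⟩

/-- The sample space `L²[0,1] × ℝ` of one observation `(X, Y)`. -/
abbrev Obs : Type := L2I × ℝ

section Regressor

variable {Ω : Type*} [MeasurableSpace Ω]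

/-- The covariance function `K(t, s) = 𝔼[X(t) X(s)]` of a centered process. -/
def covFun (X : unitInterval → Ω → ℝ) (Q : Measure Ω) (t s : unitInterval) : ℝ :=
  ∫ ω, X t ω * X s ω ∂Q

/-- A function of two variables is strictly positive definite if all its Gram matrices at
finitely many distinct points are positive definite. -/
def StrictlyPosDef (K : unitInterval → unitInterval → ℝ) : Prop :=
  ∀ (n : ℕ) (t : Fin n → unitInterval), Function.Injective t →
    (Matrix.of fun i j => K (t i) (t j)).PosDef

/-- A (jointly measurable) centered second-order process on `[0,1]` with trajectories in
`L²[0,1]` and with a continuous, strictly positive definite covariance function. -/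
structure IsRegressor (X : unitInterval → Ω → ℝ) (Q : Measure Ω) : Prop where
  measurable : Measurable (Function.uncurry X)
  memLp_path : ∀ ω, MemLp (fun t => X t ω) 2 (volume : Measure unitInterval)
  memLp : ∀ t, MemLp (X t) 2 Q
  centered : ∀ t, ∫ ω, X t ω ∂Q = 0
  continuous_cov : Continuous (Function.uncurry (covFun X Q))
  strictlyPosDef : StrictlyPosDef (covFun X Q)

end Regressor

/-- The parameter space `Θ_p` of all `θ = (b, τ, α₀, σ²)` with `b ∈ ℝ^p`, `τ ∈ [0,1]^p`, `α₀ ∈ ℝ`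
and `σ² ∈ [0, ∞)`, with its Borel sigma-algebra. -/
abbrev Param (p : ℕ) : Type := (Fin p → ℝ) × (Fin p → unitInterval) × ℝ × ℝ≥0

namespace Param

variable {p : ℕ}

/-- The coefficients `b = (β_1, …, β_p)`. -/
abbrev coef (θ : Param p) : Fin p → ℝ := θ.1

/-- The impact times `τ = (t_1, …, t_p)`. -/
abbrev time (θ : Param p) : Fin p → unitInterval := θ.2.1

/-- The intercept `α₀`. -/
abbrev icpt (θ : Param p) : ℝ := θ.2.2.1

/-- The error variance `σ²`. -/
abbrev var (θ : Param p) : ℝ≥0 := θ.2.2.2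

/-- The relabelled parameter `θ[ν]`. -/
def relabel (θ : Param p) (ν : Equiv.Perm (Fin p)) : Param p :=
  (fun j => θ.coef (ν j), fun j => θ.time (ν j), θ.icpt, θ.var)

/-- The Euclidean distance of `ℝ^(2p+2)` on `Θ_p`. -/
def eucDist (θ θ' : Param p) : ℝ :=
  Real.sqrt (∑ j, (θ.coef j - θ'.coef j) ^ 2 + ∑ j, ((θ.time j : ℝ) - θ'.time j) ^ 2
    + (θ.icpt - θ'.icpt) ^ 2 + ((θ.var : ℝ) - θ'.var) ^ 2)

/-- The metric `d(θ, θ') = min {‖θ - θ'‖, 1}` on `Θ_p`. -/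
def d (θ θ' : Param p) : ℝ := min (eucDist θ θ') 1

/-- The set `B̃(θ₀, ε)` of the parameters within `ε` of some relabelling of `θ₀`. -/
def ballUpToPerm (θ₀ : Param p) (ε : ℝ) : Set (Param p) :=
  ⋃ ν : Equiv.Perm (Fin p), {θ | d θ (θ₀.relabel ν) < ε}

/-- As `eucDist θ θ'`, but the times of those components whose coefficient in `θ'` is zero do not
count. -/
def activeDist (θ θ' : Param p) : ℝ :=
  Real.sqrt (∑ j, (θ.coef j - θ'.coef j) ^ 2
    + ∑ j, (if θ'.coef j = 0 then 0 else ((θ.time j : ℝ) - θ'.time j) ^ 2)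
    + (θ.icpt - θ'.icpt) ^ 2 + ((θ.var : ℝ) - θ'.var) ^ 2)

/-- The parameters within `ε` of some relabelling of `θ₀`, the times of the components of `θ₀`
with zero coefficient being disregarded. -/
def activeBallUpToPerm (θ₀ : Param p) (ε : ℝ) : Set (Param p) :=
  ⋃ ν : Equiv.Perm (Fin p), {θ | min (activeDist θ (θ₀.relabel ν)) 1 < ε}

end Param

section Model

variable {Ω : Type*} [MeasurableSpace Ω] {X : unitInterval → Ω → ℝ} {Q : Measure Ω} {p : ℕ}

/-- The trajectory of the process as a point of `L²[0,1]`. -/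
def path (hX : IsRegressor X Q) (ω : Ω) : L2I := (hX.memLp_path ω).toLp (fun t => X t ω)

/-- The regression function `α₀ + ∑ j, β_j X(t_j)`. -/
def regression (X : unitInterval → Ω → ℝ) (θ : Param p) (ω : Ω) : ℝ :=
  θ.icpt + ∑ j, θ.coef j * X (θ.time j) ω

/-- The sampling distribution `P_θ`: the law of `(X, Y)`, where `Y = α₀ + ∑ j, β_j X(t_j) + e` and
`e ∼ N(0, σ²)` is independent of `X`. -/
def dataLaw (hX : IsRegressor X Q) (θ : Param p) : Measure Obs :=
  (Q.prod (gaussianReal 0 θ.var)).map (fun z => (path hX z.1, regression X θ z.1 + z.2))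

theorem measurable_path (hX : IsRegressor X Q) : Measurable (path hX) := by
  have : Fact ((2 : ℝ≥0∞) ≠ ∞) := ⟨by simp⟩
  have key : ∀ g : L2I, Measurable fun ω => edist (path hX ω) g := by
    intro g
    have h1 : ∀ ω, edist (path hX ω) g
        = (∫⁻ t, ‖X t ω - g t‖ₑ ^ (2 : ℝ)) ^ (1 / 2 : ℝ) := by
      intro ω
      rw [Lp.edist_def]
      have h2 : eLpNorm (⇑(path hX ω) - ⇑g) 2 (volume : Measure unitInterval)
          = eLpNorm (fun t => X t ω - g t) 2 (volume : Measure unitInterval) := by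
        apply eLpNorm_congr_ae
        filter_upwards [(hX.memLp_path ω).coeFn_toLp] with t ht
        simp only [Pi.sub_apply, path, ht]
      rw [h2, eLpNorm_eq_lintegral_rpow_enorm_toReal (by simp) (by simp)]
      simp
    simp_rw [h1]
    have hg : Measurable g := (Lp.stronglyMeasurable g).measurable
    have hXm := hX.measurable
    apply Measurable.pow_const
    apply Measurable.lintegral_prod_left (f := fun t ω => ‖X t ω - g t‖ₑ ^ (2 : ℝ))
    have : Measurable fun q : unitInterval × Ω => X q.1 q.2 - g q.1 :=
      Measurable.sub hXm (hg.comp measurable_fst)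
    exact this.enorm.pow_const _
  refine measurable_of_isOpen fun U hU => ?_
  obtain ⟨T, hT, hTc, hTU⟩ : ∃ T : Set (L2I × ℝ≥0∞), (∀ q ∈ T, Metric.eball q.1 q.2 ⊆ U) ∧
      T.Countable ∧ U ⊆ ⋃ q ∈ T, Metric.eball q.1 q.2 := by
    have hpos : ∀ x : U, ∃ r > 0, Metric.eball (x : L2I) r ⊆ U := fun x =>
      EMetric.isOpen_iff.1 hU x x.2
    choose r hr0 hrU using hpos
    obtain ⟨S, hSc, hS⟩ := TopologicalSpace.isOpen_iUnion_countable
      (fun x : U => Metric.eball (x : L2I) (r x)) (fun x => Metric.isOpen_eball)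
    refine ⟨(fun x : U => ((x : L2I), r x)) '' S, ?_, hSc.image _, ?_⟩
    · rintro _ ⟨x, -, rfl⟩
      exact hrU x
    · intro x hx
      have : x ∈ ⋃ i ∈ S, Metric.eball (i : L2I) (r i) := by
        rw [hS]
        exact Set.mem_iUnion.2 ⟨⟨x, hx⟩, Metric.mem_eball_self (hr0 _)⟩
      simp only [Set.biUnion_image]
      exact this
  have hU' : U = ⋃ q ∈ T, Metric.eball q.1 q.2 :=
    Set.Subset.antisymm hTU (Set.iUnion₂_subset hT)
  rw [hU', Set.preimage_iUnion₂]
  refine MeasurableSet.biUnion hTc fun q _ => ?_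
  exact measurableSet_lt (key q.1) measurable_const

theorem measurable_regression (hX : IsRegressor X Q) :
    Measurable fun q : Param p × Ω => regression X q.1 q.2 := by
  have hXm := hX.measurable
  unfold regression
  refine Measurable.add (by fun_prop) (Finset.measurable_sum _ fun j _ => ?_)
  refine Measurable.mul (by fun_prop) ?_
  exact hXm.comp (f := fun q : Param p × Ω => (q.1.time j, q.2)) (by fun_prop)

theorem dataLaw_eq (hX : IsRegressor X Q) [IsProbabilityMeasure Q] (θ : Param p) :
    dataLaw hX θ = (Q.prod (gaussianReal 0 1)).map
      (fun z => (path hX z.1, regression X θ z.1 + Real.sqrt θ.var * z.2)) := by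
  have h1 : gaussianReal 0 θ.var = (gaussianReal 0 1).map (fun x => Real.sqrt θ.var * x) := by
    rw [gaussianReal_map_const_mul]
    congr 1
    · simp
    · ext
      simp
  have hp := measurable_path hX
  have hr : Measurable (regression X θ) :=
    (measurable_regression hX).comp (measurable_const.prodMk measurable_id)
  have h2 : (Q.prod (gaussianReal 0 1)).map (Prod.map id fun x => Real.sqrt θ.var * x)
      = Q.prod (gaussianReal 0 θ.var) := by
    rw [h1, ← Measure.map_prod_map _ _ measurable_id (by fun_prop), Measure.map_id]
  rw [dataLaw, ← h2, Measure.map_map (by fun_prop) (by fun_prop)]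
  rfl

theorem measurable_dataLaw (hX : IsRegressor X Q) [IsProbabilityMeasure Q] :
    Measurable (dataLaw hX : Param p → Measure Obs) := by
  have hp := measurable_path hX
  have hr := measurable_regression (p := p) hX
  have hF : Measurable fun q : Param p × (Ω × ℝ) =>
      (path hX q.2.1, regression X q.1 q.2.1 + Real.sqrt q.1.var * q.2.2) := by
    refine Measurable.prodMk (by fun_prop) (Measurable.add ?_ (by fun_prop))
    exact hr.comp (f := fun q : Param p × (Ω × ℝ) => (q.1, q.2.1)) (by fun_prop)
  refine Measure.measurable_of_measurable_coe _ fun s hs => ?_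
  have h : ∀ θ : Param p, dataLaw hX θ s = (Q.prod (gaussianReal 0 1)) (Prod.mk θ ⁻¹'
      ((fun q : Param p × (Ω × ℝ) =>
      (path hX q.2.1, regression X q.1 q.2.1 + Real.sqrt q.1.var * q.2.2)) ⁻¹' s)) := by
    intro θ
    rw [dataLaw_eq]
    exact Measure.map_apply (hF.comp (measurable_prodMk_left (x := θ))) hs
  simp_rw [h]
  exact measurable_measure_prodMk_left (hF hs)

instance isProbabilityMeasure_dataLaw (hX : IsRegressor X Q) [IsProbabilityMeasure Q]
    (θ : Param p) : IsProbabilityMeasure (dataLaw hX θ) := by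
  have hp := measurable_path hX
  have hr : Measurable (regression X θ) :=
    (measurable_regression hX).comp (measurable_const.prodMk measurable_id)
  exact Measure.isProbabilityMeasure_map (by fun_prop)

/-- The law `P_θ^∞` of an i.i.d. sequence `(X_1, Y_1), (X_2, Y_2), …` with distribution `P_θ`. -/
def seqLaw (hX : IsRegressor X Q) [IsProbabilityMeasure Q] (θ : Param p) : Measure (ℕ → Obs) :=
  Measure.infinitePi fun _ => dataLaw hX θ

instance isProbabilityMeasure_seqLaw (hX : IsRegressor X Q) [IsProbabilityMeasure Q]
    (θ : Param p) : IsProbabilityMeasure (seqLaw hX θ) := by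
  unfold seqLaw
  infer_instance

theorem measurable_seqLaw (hX : IsRegressor X Q) [IsProbabilityMeasure Q] :
    Measurable (seqLaw hX : Param p → Measure (ℕ → Obs)) := by
  refine Measurable.measure_of_isPiSystem_of_isProbabilityMeasure
    (S := squareCylinders fun _ : ℕ => {s : Set Obs | MeasurableSet s})
    (generateFrom_squareCylinders (α := fun _ : ℕ => Obs)).symm
    (isPiSystem_squareCylinders (fun _ => MeasurableSpace.isPiSystem_measurableSet)
      (fun _ => MeasurableSet.univ (α := Obs))) ?_
  rintro _ ⟨s, t, ht, rfl⟩
  have ht' : ∀ i ∈ s, MeasurableSet (t i) := fun i _ => ht i (Set.mem_univ i)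
  simp_rw [seqLaw, Measure.infinitePi_pi _ ht']
  exact Finset.measurable_prod _ fun i hi =>
    (Measure.measurable_coe (ht' i hi)).comp (measurable_dataLaw hX)

/-- The statistical model: the law of the whole data sequence as a function of the parameter. -/
def seqKernel (hX : IsRegressor X Q) [IsProbabilityMeasure Q] (p : ℕ) :
    Kernel (Param p) (ℕ → Obs) :=
  ⟨seqLaw hX, measurable_seqLaw hX⟩

instance isMarkovKernel_seqKernel (hX : IsRegressor X Q) [IsProbabilityMeasure Q] (p : ℕ) :
    IsMarkovKernel (seqKernel hX p) :=
  ⟨fun θ => isProbabilityMeasure_seqLaw hX θ⟩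

/-- The Bayesian joint law of the random parameter and of the data sequence: the parameter has
law `prior`, and given that it equals `θ` the data are i.i.d. with distribution `P_θ`. -/
def jointLaw (hX : IsRegressor X Q) [IsProbabilityMeasure Q] (prior : Measure (Param p)) :
    Measure (Param p × (ℕ → Obs)) :=
  prior ⊗ₘ seqKernel hX p

/-- The first `n` observations of a data sequence. -/
def firstObs (n : ℕ) (z : ℕ → Obs) : Fin n → Obs := fun i => z i

/-- `ρ` is a posterior distribution given `n` observations: a regular conditional distribution of
the parameter given `(X_1, Y_1), …, (X_n, Y_n)` under the joint law. -/
def IsPosterior (hX : IsRegressor X Q) [IsProbabilityMeasure Q] (prior : Measure (Param p)) (n : ℕ)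
    (ρ : Kernel (Fin n → Obs) (Param p)) : Prop :=
  IsMarkovKernel ρ ∧
    ((jointLaw hX prior).map fun q => firstObs n q.2) ⊗ₘ ρ
      = (jointLaw hX prior).map fun q => (firstObs n q.2, q.1)

/-- Posterior distributions exist. -/
theorem exists_isPosterior (hX : IsRegressor X Q) [IsProbabilityMeasure Q]
    (prior : Measure (Param p)) [IsProbabilityMeasure prior] (n : ℕ) :
    ∃ ρ, IsPosterior hX prior n ρ := by
  have : IsProbabilityMeasure (jointLaw hX prior) := by
    unfold jointLaw
    infer_instance
  exact ⟨condDistrib Prod.fst (fun q => firstObs n q.2) (jointLaw hX prior), inferInstance,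
    compProd_map_condDistrib (by fun_prop)⟩

end Model

end FunctionalRegression

end

/-!
The statement is an instance of Doob's posterior consistency theorem, combined with an
identifiability result for the model.

*Identifiability.* The errors are centered and independent of `X`, so under `P_θ` the covariance
of `Y` with `⟨X, g⟩` is `∫ F_θ g`, where `F_θ(s) = ∑ j, β_j K(t_j, s)`. Letting `g` run through a
dense sequence of `L²[0,1]` these numbers determine `F_θ` (`crossCov`) almost everywhere, hence
everywhere because `K` is continuous. Strict positive definiteness of `K` then determines the signed
measure `∑ j, β_j δ_{t_j}` (`mass_eq_of_crossCov_eq`). If the times are distinct, this measure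
determines the coefficients and the times of the nonzero coefficients up to relabelling
(`exists_perm_of_mass_eq`). Finally `𝔼[Y] = α₀`, and `𝔼[Y²]` exceeds a functional of `α₀` and of the
measure by `σ²`. Thus countably many moments of the sampling distribution (`testStat`) identify the
parameter as far as it can be identified.

*Consistency.* By the strong law of large numbers these moments are almost surely functions of the
infinite data sequence. A Borel set `A` of parameters which is saturated, i.e. membership in which
depends on the moments only, is the preimage of a Borel set of moment sequences by Lusin's
separation theorem. So `{θ ∈ A}` is almost surely an event about the data sequence, and Lévy's
upward theorem shows that its posterior probability tends to one for almost every parameter in `A`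
(`ae_tendsto_posterior_of_moments`). This is applied to a countable family of saturated sets
(`cell`), which is rich enough that every `activeBallUpToPerm θ₀ ε` contains a member to which `θ₀`
belongs.
-/

/-! ### Doob's theorem for a set determined by countably many moments -/

section Doob

variable {Θ E : Type*} [MeasurableSpace Θ] [MeasurableSpace E]

/-- The filtration on the joint space of parameter and data generated by the successive
observations. -/
def dataFiltration (Θ E : Type*) [MeasurableSpace Θ] [MeasurableSpace E] :
    Filtration ℕ (inferInstance : MeasurableSpace (Θ × (ℕ → E))) where
  seq n := MeasurableSpace.comap (fun q : Θ × (ℕ → E) => fun i : Fin n => q.2 i) inferInstance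
  mono' n m hnm := by
    have h : (fun q : Θ × (ℕ → E) => fun i : Fin n => q.2 i)
        = (fun (x : Fin m → E) (i : Fin n) => x (Fin.castLE hnm i))
          ∘ fun q : Θ × (ℕ → E) => fun i : Fin m => q.2 i := rfl
    simp only
    rw [h, ← MeasurableSpace.comap_comp]
    refine MeasurableSpace.comap_mono (Measurable.comap_le ?_)
    fun_prop
  le' n := by
    refine Measurable.comap_le ?_
    fun_prop

theorem comap_snd_le_iSup_dataFiltration :
    MeasurableSpace.comap (Prod.snd : Θ × (ℕ → E) → ℕ → E) inferInstance
      ≤ ⨆ n, dataFiltration Θ E n := by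
  change MeasurableSpace.comap _ (⨆ k, MeasurableSpace.comap (fun z : ℕ → E => z k) _) ≤ _
  rw [MeasurableSpace.comap_iSup]
  refine iSup_le fun k => le_iSup_of_le (k + 1) ?_
  rw [MeasurableSpace.comap_comp, ← measurable_iff_comap_le]
  exact (by fun_prop : Measurable fun x : Fin (k + 1) → E => x (Fin.last k)).comp
    (comap_measurable _)

/-- If the event `{θ ∈ A}` is, up to a null set of the joint law, an event `C` about the whole data
sequence, then on that event its posterior probability tends to one: the posterior probabilities
are the conditional expectations of its indicator along the filtration of the data, so Lévy's upward
theorem applies. -/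
theorem ae_tendsto_posterior [StandardBorelSpace Θ] [Nonempty Θ] {J : Measure (Θ × (ℕ → E))}
    [IsProbabilityMeasure J] {post : (n : ℕ) → Kernel (Fin n → E) Θ}
    (hmarkov : ∀ n, IsMarkovKernel (post n))
    (hpost : ∀ n, (J.map fun q => fun i : Fin n => q.2 i) ⊗ₘ post n
      = J.map fun q => ((fun i : Fin n => q.2 i), q.1))
    {A : Set Θ} (hA : MeasurableSet A) {C : Set (ℕ → E)} (hC : MeasurableSet C)
    (hAC : ∀ᵐ q ∂J, q.1 ∈ A ↔ q.2 ∈ C) :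
    ∀ᵐ q ∂J, q.1 ∈ A → Tendsto (fun n => post n (fun i : Fin n => q.2 i) A) atTop (𝓝 1) := by
  -- `g` is the version of the indicator of `{θ ∈ A}` which is measurable with respect to the data.
  set g : Θ × (ℕ → E) → ℝ := (Prod.snd ⁻¹' C).indicator fun _ => 1 with hg
  have hgm : StronglyMeasurable[⨆ n, dataFiltration Θ E n] g :=
    stronglyMeasurable_const.indicator (comap_snd_le_iSup_dataFiltration _ ⟨C, hC, rfl⟩)
  have hgi : Integrable g J := (integrable_const 1).indicator (measurable_snd hC)
  have hAg : (Prod.fst ⁻¹' A).indicator (fun _ => (1 : ℝ)) =ᵐ[J] g := by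
    filter_upwards [hAC] with q hq
    by_cases h : q.1 ∈ A
    · simp [hg, h, hq.1 h]
    · have hC : q.2 ∉ C := fun h' => h (hq.2 h')
      simp [hg, h, hC]
  have hcond : ∀ n, ∀ᵐ q ∂J,
      (post n (fun i : Fin n => q.2 i)).real A = (J[g | dataFiltration Θ E n]) q := by
    intro n
    have hm : Measurable fun q : Θ × (ℕ → E) => fun i : Fin n => q.2 i := by fun_prop
    have h1 := ae_of_ae_map hm.aemeasurable (condDistrib_ae_eq_of_measure_eq_compProd
      (fun q : Θ × (ℕ → E) => fun i : Fin n => q.2 i) (μ := J) (Y := Prod.fst)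
      measurable_fst.aemeasurable (hpost n).symm)
    have h2 := condDistrib_ae_eq_condExp (μ := J) hm measurable_fst hA
    have h3 := condExp_congr_ae (m := dataFiltration Θ E n) hAg
    filter_upwards [h1, h2, h3] with q h1 h2 h3
    rw [← h1, h2]
    exact h3
  filter_upwards [hgi.tendsto_ae_condExp hgm, ae_all_iff.2 hcond, hAC] with q hlim hq hqC hqA
  have hg1 : g q = 1 := by simp [hg, hqC.1 hqA]
  have hlim' : Tendsto (fun n => (post n (fun i : Fin n => q.2 i)).real A) atTop (𝓝 1) := by
    simpa only [hq, hg1] using hlim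
  have := ENNReal.tendsto_ofReal hlim'
  simpa [ofReal_measureReal] using this

/-- The empirical means of an integrable function along an i.i.d. sequence recover its
expectation. -/
theorem ae_limsup_empiricalMean (P : Measure E) [IsProbabilityMeasure P] {f : E → ℝ}
    (hf : Measurable f) (hfi : Integrable f P) :
    ∀ᵐ z ∂(Measure.infinitePi fun _ : ℕ => P),
      limsup (fun n : ℕ => (∑ i ∈ Finset.range n, f (z i)) / n) atTop = ∫ x, f x ∂P := by
  have hev := fun i => measurePreserving_eval_infinitePi (fun _ : ℕ => P) i
  have hident : ∀ i, IdentDistrib (fun z : ℕ → E => f (z i)) (fun z => f (z 0))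
      (Measure.infinitePi fun _ : ℕ => P) (Measure.infinitePi fun _ : ℕ => P) := fun i =>
    IdentDistrib.comp (u := f) ⟨(hev i).measurable.aemeasurable, (hev 0).measurable.aemeasurable,
      (hev i).map_eq.trans (hev 0).map_eq.symm⟩ hf
  have hindep := iIndepFun_infinitePi (P := fun _ : ℕ => P) (X := fun _ => f) fun _ => hf
  have h := strong_law_ae_real (fun i (z : ℕ → E) => f (z i))
    ((hev 0).integrable_comp_of_integrable hfi) (fun i j hij => hindep.indepFun hij) hident
  have h0 : ∫ z, f (z 0) ∂(Measure.infinitePi fun _ : ℕ => P) = ∫ x, f x ∂P := by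
    have := integral_map (μ := Measure.infinitePi fun _ : ℕ => P) (hev 0).measurable.aemeasurable
      hf.aestronglyMeasurable
    rw [(hev 0).map_eq] at this
    exact this.symm
  filter_upwards [h] with z hz
  rw [hz.limsup_eq, h0]

/-- A form of Doob's posterior consistency theorem. Countably many moments `∫ f k ∂(P θ)` of the
sampling distribution are supposed to determine, for `θ` in a set `D` of full prior measure, whether
`θ` lies in `A`. By the strong law these moments are functions of the data sequence. That membership
in `A` is a Borel function of the moments is Lusin's separation theorem, applied to the images of
`A ∩ D` and `Aᶜ ∩ D`. -/
theorem ae_tendsto_posterior_of_moments [StandardBorelSpace Θ] [Nonempty Θ]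
    {prior : Measure Θ} [IsProbabilityMeasure prior] {P : Kernel Θ E} [IsMarkovKernel P]
    {η : Kernel Θ (ℕ → E)} [IsMarkovKernel η] (hη : ∀ θ, η θ = Measure.infinitePi fun _ => P θ)
    {post : (n : ℕ) → Kernel (Fin n → E) Θ} (hmarkov : ∀ n, IsMarkovKernel (post n))
    (hpost : ∀ n, ((prior ⊗ₘ η).map fun q => fun i : Fin n => q.2 i) ⊗ₘ post n
      = (prior ⊗ₘ η).map fun q => ((fun i : Fin n => q.2 i), q.1))
    {ι : Type*} [Countable ι] {f : ι → E → ℝ} (hf : ∀ k, Measurable (f k))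
    (hfi : ∀ k θ, Integrable (f k) (P θ))
    {D : Set Θ} (hD : MeasurableSet D) (hprior : ∀ᵐ θ ∂prior, θ ∈ D)
    {A : Set Θ} (hA : MeasurableSet A)
    (hsat : ∀ θ ∈ D, ∀ θ' ∈ D, (∀ k, ∫ x, f k x ∂(P θ) = ∫ x, f k x ∂(P θ')) → θ ∈ A → θ' ∈ A) :
    ∀ᵐ θ ∂prior, θ ∈ A →
      ∀ᵐ z ∂(η θ), Tendsto (fun n => post n (fun i : Fin n => z i) A) atTop (𝓝 1) := by
  set h : Θ → ι → ℝ := fun θ k => ∫ x, f k x ∂(P θ) with hh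
  have hhm : Measurable h := measurable_pi_lambda _ fun k =>
    ((hf k).stronglyMeasurable.integral_kernel (κ := P)).measurable
  obtain ⟨B, hAB, hBA, hB⟩ := ((hA.inter hD).analyticSet_image hhm).measurablySeparable
    ((hA.compl.inter hD).analyticSet_image hhm) (by
      rw [Set.disjoint_left]
      rintro _ ⟨θ, ⟨hθA, hθD⟩, rfl⟩ ⟨θ', ⟨hθA', hθD'⟩, h'⟩
      exact hθA' (hsat θ hθD θ' hθD' (fun k => (congrFun h' k).symm) hθA))
  set H : (ℕ → E) → ι → ℝ := fun z k =>
    limsup (fun n : ℕ => (∑ i ∈ Finset.range n, f k (z i)) / n) atTop with hH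
  have hHm : Measurable H := measurable_pi_lambda _ fun k => Measurable.limsup fun n =>
    (Finset.measurable_sum _ fun i _ => (hf k).comp (measurable_pi_apply i)).div_const _
  have hHh : ∀ᵐ q ∂(prior ⊗ₘ η), H q.2 = h q.1 ∧ q.1 ∈ D := by
    refine Measure.ae_compProd_of_ae_ae
      ((measurableSet_eq_fun (by fun_prop) (by fun_prop)).inter (measurable_fst hD)) ?_
    filter_upwards [hprior] with θ hθ
    have : ∀ᵐ z ∂(η θ), ∀ k, H z k = h θ k := by
      rw [hη, ae_all_iff]
      exact fun k => ae_limsup_empiricalMean (P θ) (hf k) (hfi k θ)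
    filter_upwards [this] with z hz
    exact ⟨funext hz, hθ⟩
  have key := ae_tendsto_posterior (J := prior ⊗ₘ η) hmarkov hpost hA (hHm hB) (by
    filter_upwards [hHh] with q hq
    rw [Set.mem_preimage, hq.1]
    refine ⟨fun hqA => hAB ⟨_, ⟨hqA, hq.2⟩, rfl⟩, fun hqB => ?_⟩
    by_contra hqA
    exact Set.disjoint_left.1 hBA ⟨_, ⟨hqA, hq.2⟩, rfl⟩ hqB)
  filter_upwards [Measure.ae_ae_of_ae_compProd key] with θ hθ hθA
  filter_upwards [hθ] with z hz using hz hθA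

end Doob

/-! ### Moments of the sampling distribution -/

namespace FunctionalRegression

section Moments

variable {Ω : Type*} [MeasurableSpace Ω] {X : unitInterval → Ω → ℝ} {Q : Measure Ω} {p : ℕ}

/-- The exponent of `L2I` is finite; this is what the separability of `L2I` rests on. -/
instance instFactTwoNeTop : Fact ((2 : ℝ≥0∞) ≠ ∞) := ⟨by simp⟩

theorem isOpenPosMeasure_volume_unitInterval :
    (volume : Measure unitInterval).IsOpenPosMeasure := by
  refine ⟨fun U hU hne => ?_⟩
  obtain ⟨V, hV, rfl⟩ := isOpen_induced_iff.1 hU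
  obtain ⟨x, hx⟩ := hne
  have hcl : (x : ℝ) ∈ closure (Set.Ioo (0 : ℝ) 1) := by
    rw [closure_Ioo zero_ne_one]
    exact x.2
  have hpos := (hV.inter isOpen_Ioo).measure_pos volume (mem_closure_iff.1 hcl V hV hx)
  rw [Measure.Subtype.volume_def, comap_subtype_coe_apply measurableSet_Icc,
    Subtype.image_preimage_coe]
  refine (hpos.trans_le (measure_mono ?_)).ne'
  exact fun y hy => ⟨Set.Ioo_subset_Icc_self hy.2, hy.1⟩

/-- The covariance of the regression function with the process, as a function of time. -/
noncomputable def crossCov (X : unitInterval → Ω → ℝ) (Q : Measure Ω) (θ : Param p)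
    (s : unitInterval) : ℝ :=
  ∑ j, θ.coef j * covFun X Q (θ.time j) s

theorem covFun_comm (t s : unitInterval) : covFun X Q t s = covFun X Q s t := by
  simp only [covFun, mul_comm]

theorem continuous_crossCov (hX : IsRegressor X Q) (θ : Param p) : Continuous (crossCov X Q θ) := by
  have := hX.continuous_cov
  unfold crossCov
  refine continuous_finsetSum _ fun j _ => continuous_const.mul ?_
  exact this.comp (by fun_prop : Continuous fun s => (θ.time j, s))

theorem memLp_uncurry [IsFiniteMeasure Q] (hX : IsRegressor X Q) :
    MemLp (fun q : Ω × unitInterval => X q.2 q.1) 2 (Q.prod volume) := by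
  have hm : Measurable fun q : Ω × unitInterval => X q.2 q.1 :=
    hX.measurable.comp measurable_swap
  rw [memLp_two_iff_integrable_sq hm.aestronglyMeasurable,
    integrable_prod_iff' (hm.pow_const 2).aestronglyMeasurable]
  refine ⟨.of_forall fun t => (hX.memLp t).integrable_sq, ?_⟩
  have h : (fun t : unitInterval => ∫ ω, ‖X t ω ^ 2‖ ∂Q) = fun t => covFun X Q t t := by
    funext t
    simp only [covFun, Real.norm_eq_abs, sq, abs_mul_self]
  have hc : Continuous fun t => covFun X Q t t :=
    hX.continuous_cov.comp (by fun_prop : Continuous fun t : unitInterval => (t, t))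
  simp only [h]
  exact hc.integrable_of_hasCompactSupport (HasCompactSupport.of_compactSpace _)

theorem inner_path (hX : IsRegressor X Q) (ω : Ω) (g : L2I) :
    inner ℝ (path hX ω) g = ∫ s, X s ω * g s := by
  rw [L2.inner_def]
  refine integral_congr_ae ?_
  filter_upwards [(hX.memLp_path ω).coeFn_toLp] with s hs
  simp [path, hs, mul_comm]

theorem memLp_norm_path [IsFiniteMeasure Q] (hX : IsRegressor X Q) :
    MemLp (fun ω => ‖path hX ω‖) 2 Q := by
  rw [memLp_two_iff_integrable_sq (measurable_path hX).norm.aestronglyMeasurable]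
  have h := (memLp_uncurry hX).integrable_sq.integral_prod_left
  refine h.congr (.of_forall fun ω => ?_)
  simp only
  rw [← real_inner_self_eq_norm_sq, inner_path]
  refine integral_congr_ae ?_
  filter_upwards [(hX.memLp_path ω).coeFn_toLp] with s hs
  simp [path, hs, sq]

theorem measurable_inner_path (hX : IsRegressor X Q) (g : L2I) :
    Measurable fun ω => inner ℝ (path hX ω) g :=
  (by fun_prop : Measurable fun x : L2I => inner ℝ x g).comp (measurable_path hX)

theorem memLp_inner_path [IsFiniteMeasure Q] (hX : IsRegressor X Q) (g : L2I) :
    MemLp (fun ω => inner ℝ (path hX ω) g) 2 Q :=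
  ((memLp_norm_path hX).mul_const ‖g‖).mono (measurable_inner_path hX g).aestronglyMeasurable
    (.of_forall fun ω => by simpa using abs_real_inner_le_norm (path hX ω) g)

theorem memLp_regression [IsFiniteMeasure Q] (hX : IsRegressor X Q) (θ : Param p) :
    MemLp (regression X θ) 2 Q := by
  have h : MemLp (fun ω => ∑ j, θ.coef j * X (θ.time j) ω) 2 Q :=
    memLp_finsetSum _ fun j _ => (hX.memLp (θ.time j)).const_mul (θ.coef j)
  have hc : MemLp (fun _ : Ω => θ.icpt) 2 Q := memLp_const _
  exact hc.add h

theorem integral_regression [IsProbabilityMeasure Q] (hX : IsRegressor X Q) (θ : Param p) :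
    ∫ ω, regression X θ ω ∂Q = θ.icpt := by
  have hi : ∀ j, Integrable (fun ω => θ.coef j * X (θ.time j) ω) Q := fun j =>
    ((hX.memLp _).integrable (by norm_num)).const_mul _
  unfold regression
  rw [integral_add (integrable_const _) (integrable_finsetSum _ fun j _ => hi j),
    integral_finsetSum _ fun j _ => hi j]
  simp [integral_const_mul, hX.centered]

theorem integral_regression_mul [IsProbabilityMeasure Q] (hX : IsRegressor X Q) (θ : Param p)
    (s : unitInterval) : ∫ ω, regression X θ ω * X s ω ∂Q = crossCov X Q θ s := by
  have hi : ∀ j, Integrable (fun ω => θ.coef j * (X (θ.time j) ω * X s ω)) Q := fun j =>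
    ((hX.memLp _).integrable_mul (hX.memLp s)).const_mul _
  simp only [regression, add_mul, Finset.sum_mul, mul_assoc]
  rw [integral_add (((hX.memLp s).integrable (by norm_num)).const_mul _)
    (integrable_finsetSum _ fun j _ => hi j), integral_finsetSum _ fun j _ => hi j]
  simp [integral_const_mul, hX.centered, crossCov, covFun]

theorem integral_regression_sq [IsProbabilityMeasure Q] (hX : IsRegressor X Q) (θ : Param p) :
    ∫ ω, regression X θ ω ^ 2 ∂Q
      = θ.icpt ^ 2 + ∑ j, θ.coef j * crossCov X Q θ (θ.time j) := by
  have hr := memLp_regression hX θ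
  have hi : ∀ j, Integrable (fun ω => θ.coef j * (regression X θ ω * X (θ.time j) ω)) Q :=
    fun j => (hr.integrable_mul (hX.memLp _)).const_mul _
  have h : ∀ ω, regression X θ ω ^ 2 = θ.icpt * regression X θ ω
      + ∑ j, θ.coef j * (regression X θ ω * X (θ.time j) ω) := by
    intro ω
    simp only [mul_left_comm _ (regression X θ ω), ← Finset.mul_sum]
    rw [sq]
    nth_rw 1 [regression]
    ring
  simp only [h]
  rw [integral_add ((hr.integrable (by norm_num)).const_mul _)
    (integrable_finsetSum _ fun j _ => hi j), integral_finsetSum _ fun j _ => hi j]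
  simp only [integral_const_mul, integral_regression hX, integral_regression_mul hX, sq]

/-- By Fubini, the regression function has the inner product of its cross-covariance with `g` as
its covariance with the linear functional `⟨·, g⟩` of the trajectory. -/
theorem integral_regression_mul_inner_path [IsProbabilityMeasure Q] (hX : IsRegressor X Q)
    (θ : Param p) (g : L2I) :
    ∫ ω, regression X θ ω * inner ℝ (path hX ω) g ∂Q = ∫ s, crossCov X Q θ s * g s := by
  have hr := memLp_regression hX θ
  have hrg : MemLp (fun q : Ω × unitInterval => regression X θ q.1 * g q.2) 2
      (Q.prod volume) := by
    rw [memLp_two_iff_integrable_sq]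
    · simp only [mul_pow]
      exact hr.integrable_sq.mul_prod (Lp.memLp g).integrable_sq
    · exact hr.1.comp_fst.mul (Lp.aestronglyMeasurable g).comp_snd
  have hint : Integrable (fun q : Ω × unitInterval => regression X θ q.1 * (X q.2 q.1 * g q.2))
      (Q.prod volume) :=
    (hrg.integrable_mul (memLp_uncurry hX)).congr (.of_forall fun q => by
      simp only [Pi.mul_apply]; ring)
  simp only [inner_path, ← integral_const_mul]
  rw [integral_integral_swap hint]
  simp only [← mul_assoc, integral_mul_const, integral_regression_mul hX]

/-- The statistics whose expectations identify the parameter: `y`, `y²` and `y * ⟨x, g⟩` for `g` in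
a dense sequence of `L²[0,1]`. -/
noncomputable def testStat : ℕ → Obs → ℝ
  | 0, x => x.2
  | 1, x => x.2 ^ 2
  | k + 2, x => x.2 * inner ℝ x.1 (TopologicalSpace.denseSeq L2I k)

theorem measurable_testStat : ∀ k, Measurable (testStat k)
  | 0 => measurable_snd
  | 1 => measurable_snd.pow_const 2
  | k + 2 => measurable_snd.mul
      ((by fun_prop : Measurable fun x : L2I =>
        inner ℝ x (TopologicalSpace.denseSeq L2I k)).comp measurable_fst)

theorem measurable_obs (hX : IsRegressor X Q) (θ : Param p) :
    Measurable fun z : Ω × ℝ => (path hX z.1, regression X θ z.1 + z.2) := by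
  have hp := measurable_path hX
  have hr : Measurable (regression X θ) :=
    (measurable_regression hX).comp (measurable_const.prodMk measurable_id)
  fun_prop

theorem memLp_response [IsProbabilityMeasure Q] (hX : IsRegressor X Q) (θ : Param p) :
    MemLp (fun z : Ω × ℝ => regression X θ z.1 + z.2) 2 (Q.prod (gaussianReal 0 θ.var)) :=
  ((memLp_regression hX θ).comp_measurePreserving measurePreserving_fst).add
    ((memLp_id_gaussianReal 2).comp_measurePreserving measurePreserving_snd)

theorem integrable_testStat [IsProbabilityMeasure Q] (hX : IsRegressor X Q) (θ : Param p) :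
    ∀ k, Integrable (testStat k) (dataLaw hX θ) := by
  intro k
  have hy := memLp_response hX θ
  rw [dataLaw, integrable_map_measure (measurable_testStat k).aestronglyMeasurable
    (measurable_obs hX θ).aemeasurable]
  match k with
  | 0 => exact hy.integrable (by norm_num)
  | 1 => exact hy.integrable_sq
  | k + 2 => exact hy.integrable_mul ((memLp_inner_path hX _).comp_measurePreserving
      measurePreserving_fst)

theorem integral_dataLaw (hX : IsRegressor X Q) (θ : Param p) {f : Obs → ℝ} (hf : Measurable f) :
    ∫ x, f x ∂(dataLaw hX θ) = ∫ z : Ω × ℝ, f (path hX z.1, regression X θ z.1 + z.2)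
      ∂(Q.prod (gaussianReal 0 θ.var)) :=
  integral_map (measurable_obs hX θ).aemeasurable hf.aestronglyMeasurable

/-- The error is independent of the regressor and centered, so it does not contribute to
the covariance of the response with a square integrable function of the regressor. -/
theorem integral_response_mul [IsProbabilityMeasure Q] (hX : IsRegressor X Q) (θ : Param p)
    {u : Ω → ℝ} (hu : MemLp u 2 Q) :
    ∫ z : Ω × ℝ, (regression X θ z.1 + z.2) * u z.1 ∂(Q.prod (gaussianReal 0 θ.var))
      = ∫ ω, regression X θ ω * u ω ∂Q := by
  have hy := memLp_response hX θ
  have hint : Integrable (fun z : Ω × ℝ => (regression X θ z.1 + z.2) * u z.1)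
      (Q.prod (gaussianReal 0 θ.var)) :=
    hy.integrable_mul (hu.comp_measurePreserving measurePreserving_fst)
  have hid : Integrable (fun e : ℝ => e) (gaussianReal 0 θ.var) :=
    (memLp_id_gaussianReal 1).integrable (by simp)
  rw [integral_prod _ hint]
  refine integral_congr_ae (.of_forall fun ω => ?_)
  simp only
  rw [integral_mul_const, integral_add (integrable_const _) hid]
  simp

theorem integral_testStat_zero [IsProbabilityMeasure Q] (hX : IsRegressor X Q) (θ : Param p) :
    ∫ x, testStat 0 x ∂(dataLaw hX θ) = θ.icpt := by
  have h := integral_response_mul hX θ (u := fun _ => 1) (memLp_const 1)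
  rw [integral_dataLaw hX θ (measurable_testStat 0)]
  simpa [testStat, integral_regression hX] using h

theorem integral_testStat_one [IsProbabilityMeasure Q] (hX : IsRegressor X Q) (θ : Param p) :
    ∫ x, testStat 1 x ∂(dataLaw hX θ)
      = θ.icpt ^ 2 + ∑ j, θ.coef j * crossCov X Q θ (θ.time j) + θ.var := by
  have hr := memLp_regression hX θ
  have hid : MemLp (fun e : ℝ => e) 2 (gaussianReal 0 θ.var) := memLp_id_gaussianReal 2
  have h1 := integral_response_mul hX θ hr
  have hvar : ∫ e, e ^ 2 ∂(gaussianReal 0 θ.var) = θ.var := by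
    have := variance_of_integral_eq_zero (μ := gaussianReal 0 θ.var) (X := id)
      aemeasurable_id (by simp)
    rw [variance_id_gaussianReal] at this
    simpa using this.symm
  have h2 : ∫ z : Ω × ℝ, (regression X θ z.1 + z.2) * z.2 ∂(Q.prod (gaussianReal 0 θ.var))
      = θ.var := by
    have hint : Integrable (fun z : Ω × ℝ => (regression X θ z.1 + z.2) * z.2)
        (Q.prod (gaussianReal 0 θ.var)) :=
      (memLp_response hX θ).integrable_mul (hid.comp_measurePreserving measurePreserving_snd)
    rw [integral_prod _ hint]
    have : ∀ ω, ∫ e, (regression X θ ω + e) * e ∂(gaussianReal 0 θ.var) = θ.var := by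
      intro ω
      simp only [add_mul, ← sq]
      rw [integral_add ((hid.integrable (by norm_num)).const_mul _) hid.integrable_sq,
        integral_const_mul, hvar]
      simp
    simp [this]
  rw [integral_dataLaw hX θ (measurable_testStat 1), ← integral_regression_sq hX]
  have h3 : ∀ z : Ω × ℝ, testStat 1 (path hX z.1, regression X θ z.1 + z.2)
      = (regression X θ z.1 + z.2) * regression X θ z.1
        + (regression X θ z.1 + z.2) * z.2 := by
    intro z
    simp only [testStat]
    ring
  simp only [h3]
  rw [integral_add, h1, h2]
  · simp only [sq]
  · exact (memLp_response hX θ).integrable_mul (hr.comp_measurePreserving measurePreserving_fst)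
  · exact (memLp_response hX θ).integrable_mul (hid.comp_measurePreserving measurePreserving_snd)

theorem integral_testStat_add_two [IsProbabilityMeasure Q] (hX : IsRegressor X Q) (θ : Param p)
    (k : ℕ) : ∫ x, testStat (k + 2) x ∂(dataLaw hX θ)
      = ∫ s, crossCov X Q θ s * TopologicalSpace.denseSeq L2I k s := by
  rw [integral_dataLaw hX θ (measurable_testStat _), ← integral_regression_mul_inner_path hX]
  exact integral_response_mul hX θ (memLp_inner_path hX _)

/-- The moments determine the cross-covariance function, first almost everywhere and then, by
continuity, everywhere. -/
theorem crossCov_eq_of_moments [IsProbabilityMeasure Q] (hX : IsRegressor X Q) {θ θ' : Param p}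
    (h : ∀ k, ∫ x, testStat k x ∂(dataLaw hX θ) = ∫ x, testStat k x ∂(dataLaw hX θ')) :
    crossCov X Q θ = crossCov X Q θ' := by
  have := isOpenPosMeasure_volume_unitInterval
  have hmem : ∀ θ : Param p, MemLp (crossCov X Q θ) 2 (volume : Measure unitInterval) := fun θ =>
    (continuous_crossCov hX θ).memLp_of_hasCompactSupport (HasCompactSupport.of_compactSpace _)
  have hinner : ∀ (θ : Param p) (g : L2I),
      inner ℝ ((hmem θ).toLp _) g = ∫ s, crossCov X Q θ s * g s := by
    intro θ g
    rw [L2.inner_def]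
    refine integral_congr_ae ?_
    filter_upwards [(hmem θ).coeFn_toLp] with s hs
    simp [hs, mul_comm]
  have heq : (hmem θ).toLp _ = (hmem θ').toLp _ := by
    refine (TopologicalSpace.denseRange_denseSeq L2I).eq_of_inner_left ℝ ?_
    intro k
    rw [hinner, hinner, ← integral_testStat_add_two hX, ← integral_testStat_add_two hX, h]
  exact (Continuous.ae_eq_iff_eq volume (continuous_crossCov hX θ) (continuous_crossCov hX θ')).1
    ((MemLp.toLp_eq_toLp_iff _ _).1 heq)

end Moments

/-! ### Identifiability -/

section Identifiability

variable {Ω : Type*} [MeasurableSpace Ω] {X : unitInterval → Ω → ℝ} {Q : Measure Ω} {p : ℕ}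

/-- The mass at `t` of the signed measure `∑ j, β_j δ_{t_j}`. -/
noncomputable def mass (θ : Param p) (t : unitInterval) : ℝ :=
  ∑ j, if θ.time j = t then θ.coef j else 0

theorem sum_mass_mul (θ : Param p) {S : Finset unitInterval} (hS : ∀ j, θ.time j ∈ S)
    (f : unitInterval → ℝ) : ∑ t ∈ S, mass θ t * f t = ∑ j, θ.coef j * f (θ.time j) := by
  simp only [mass, Finset.sum_mul]
  rw [Finset.sum_comm]
  refine Finset.sum_congr rfl fun j _ => ?_
  simp [ite_mul, hS j]

theorem mass_time {θ : Param p} (hθ : Function.Injective θ.time) (j : Fin p) :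
    mass θ (θ.time j) = θ.coef j := by
  simp [mass, hθ.eq_iff]

/-- A signed measure with finite support is determined by its cross-covariance function: the
quadratic form of a Gram matrix vanishes at the difference of two weight vectors with the same
cross-covariance function. -/
theorem mass_eq_of_crossCov_eq (hX : IsRegressor X Q) {θ θ' : Param p}
    (h : crossCov X Q θ = crossCov X Q θ') : mass θ = mass θ' := by
  classical
  set S : Finset unitInterval := Finset.univ.image θ.time ∪ Finset.univ.image θ'.time with hS
  have hmem : ∀ j, θ.time j ∈ S := fun j => by simp [hS]
  have hmem' : ∀ j, θ'.time j ∈ S := fun j => by simp [hS]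
  set e : Fin S.card → unitInterval := fun i => S.equivFin.symm i with he
  have he_inj : Function.Injective e := Subtype.val_injective.comp S.equivFin.symm.injective
  have hsum : ∀ f : unitInterval → ℝ, ∑ i, f (e i) = ∑ t ∈ S, f t := fun f => by
    rw [← Finset.sum_coe_sort S]
    exact Equiv.sum_comp S.equivFin.symm fun t : S => f t
  set x : Fin S.card → ℝ := fun i => mass θ (e i) - mass θ' (e i) with hx
  have hx0 : x = 0 := by
    by_contra hne
    have hpos := (hX.strictlyPosDef S.card e he_inj).dotProduct_mulVec_pos hne
    have hzero : ∀ i, (Matrix.of fun i j => covFun X Q (e i) (e j)).mulVec x i = 0 := by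
      intro i
      have h1 := hsum fun t => mass θ t * covFun X Q t (e i)
      have h2 := hsum fun t => mass θ' t * covFun X Q t (e i)
      rw [sum_mass_mul θ hmem] at h1
      rw [sum_mass_mul θ' hmem'] at h2
      have h3 := congrFun h (e i)
      simp only [crossCov] at h3
      rw [← h1, ← h2, ← sub_eq_zero, ← Finset.sum_sub_distrib] at h3
      rw [← h3]
      simp only [Matrix.mulVec, dotProduct, Matrix.of_apply, hx]
      refine Finset.sum_congr rfl fun j _ => ?_
      rw [covFun_comm]
      ring
    rw [funext hzero] at hpos
    simp [dotProduct] at hpos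
  funext t
  by_cases ht : t ∈ S
  · have := congrFun hx0 (S.equivFin ⟨t, ht⟩)
    simpa [hx, he, sub_eq_zero] using this
  · have h1 : ∀ j, θ.time j ≠ t := fun j hj => ht (hj ▸ hmem j)
    have h2 : ∀ j, θ'.time j ≠ t := fun j hj => ht (hj ▸ hmem' j)
    simp [mass, h1, h2]

theorem exists_time_eq_of_mass_eq {θ θ' : Param p} (hθ : Function.Injective θ.time)
    (hθ' : Function.Injective θ'.time) (h : mass θ = mass θ') {j : Fin p} (hj : θ'.coef j ≠ 0) :
    ∃ i, θ.time i = θ'.time j ∧ θ.coef i = θ'.coef j := by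
  have hm : mass θ (θ'.time j) = θ'.coef j := by rw [h, mass_time hθ']
  obtain ⟨i, -, hi⟩ := Finset.exists_ne_zero_of_sum_ne_zero
    (show mass θ (θ'.time j) ≠ 0 by rwa [hm])
  have hij : θ.time i = θ'.time j := by
    by_contra hne
    simp [hne] at hi
  exact ⟨i, hij, by rw [← mass_time hθ, hij, hm]⟩

/-- Two parameters with distinct times which define the same signed measure agree, up to
relabelling, in their coefficients and in the times of the nonzero coefficients. -/
theorem exists_perm_of_mass_eq {θ θ' : Param p} (hθ : Function.Injective θ.time)
    (hθ' : Function.Injective θ'.time) (h : mass θ = mass θ') :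
    ∃ ν : Equiv.Perm (Fin p), ∀ j, θ'.coef j = θ.coef (ν j) ∧
      (θ'.coef j ≠ 0 → θ'.time j = θ.time (ν j)) := by
  classical
  choose f hft hfc using fun j : {j // θ'.coef j ≠ 0} =>
    exists_time_eq_of_mass_eq hθ hθ' h j.2
  let F : {j // θ'.coef j ≠ 0} → {i // θ.coef i ≠ 0} := fun j => ⟨f j, by rw [hfc]; exact j.2⟩
  have hF : Function.Bijective F := by
    refine ⟨fun i j hij => ?_, fun i => ?_⟩
    · have : f i = f j := congrArg Subtype.val hij
      exact Subtype.ext (hθ' (by rw [← hft, ← hft, this]))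
    · obtain ⟨j, hjt, hjc⟩ := exists_time_eq_of_mass_eq hθ' hθ h.symm i.2
      have hj : θ'.coef j ≠ 0 := by rw [hjc]; exact i.2
      exact ⟨⟨j, hj⟩, Subtype.ext (hθ (by rw [hft, hjt]))⟩
  refine ⟨(Equiv.ofBijective F hF).extendSubtype, fun j => ?_⟩
  by_cases hj : θ'.coef j = 0
  · have := (Equiv.ofBijective F hF).extendSubtype_not_mem j (not_not.2 hj)
    exact ⟨hj.trans (not_not.1 this).symm, fun hne => absurd hj hne⟩
  · rw [(Equiv.ofBijective F hF).extendSubtype_apply_of_mem j hj]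
    exact ⟨(hfc ⟨j, hj⟩).symm, fun _ => (hft ⟨j, hj⟩).symm⟩

/-- The moments of `testStat` identify a parameter with distinct times, up to relabelling and
up to the times of the components with zero coefficient. -/
theorem exists_perm_of_moments [IsProbabilityMeasure Q] (hX : IsRegressor X Q) {θ θ' : Param p}
    (hθ : Function.Injective θ.time) (hθ' : Function.Injective θ'.time)
    (h : ∀ k, ∫ x, testStat k x ∂(dataLaw hX θ) = ∫ x, testStat k x ∂(dataLaw hX θ')) :
    (∃ ν : Equiv.Perm (Fin p), ∀ j, θ'.coef j = θ.coef (ν j) ∧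
      (θ'.coef j ≠ 0 → θ'.time j = θ.time (ν j))) ∧ θ'.icpt = θ.icpt ∧ θ'.var = θ.var := by
  have hcov := crossCov_eq_of_moments hX h
  obtain ⟨ν, hν⟩ := exists_perm_of_mass_eq hθ hθ' (mass_eq_of_crossCov_eq hX hcov)
  have h0 := h 0
  have h1 := h 1
  rw [integral_testStat_zero, integral_testStat_zero] at h0
  rw [integral_testStat_one, integral_testStat_one, h0, ← hcov] at h1
  have hquad : ∑ j, θ'.coef j * crossCov X Q θ (θ'.time j)
      = ∑ j, θ.coef j * crossCov X Q θ (θ.time j) := by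
    rw [← Equiv.sum_comp ν fun j => θ.coef j * crossCov X Q θ (θ.time j)]
    refine Finset.sum_congr rfl fun j _ => ?_
    by_cases hj : θ'.coef j = 0
    · rw [← (hν j).1, hj, zero_mul, zero_mul]
    · rw [(hν j).2 hj, (hν j).1]
  rw [hquad] at h1
  exact ⟨⟨ν, hν⟩, h0.symm, NNReal.coe_injective (add_left_cancel h1).symm⟩

end Identifiability

/-! ### Countably many neighbourhoods -/

section Neighbourhoods

variable {p : ℕ}

/-- The parameters `θ` all of whose coordinates are within `r` of those of some relabelling of `q`,
the times of the components with zero coefficient in `θ` being disregarded. That `θ`, and not the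
centre `q`, decides which times count makes membership depend on the sampling distribution of `θ`
only. -/
def cell (q : Param p) (r : ℝ) : Set (Param p) :=
  {θ | ∃ ν : Equiv.Perm (Fin p), (∀ j, |θ.coef j - q.coef (ν j)| < r ∧
    (θ.coef j ≠ 0 → |(θ.time j : ℝ) - q.time (ν j)| < r)) ∧ |θ.icpt - q.icpt| < r ∧
    |(θ.var : ℝ) - q.var| < r}

theorem measurableSet_cell (q : Param p) (r : ℝ) : MeasurableSet (cell q r) := by
  have hlt : ∀ f : Param p → ℝ, Measurable f → ∀ c : ℝ, Measurable fun θ => |f θ - c| < r :=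
    fun f hf c => measurableSet_setOfPred.1 (measurableSet_lt (by fun_prop) measurable_const)
  refine measurableSet_setOfPred.2 (Measurable.exists fun ν => Measurable.and
    (Measurable.forall fun j => Measurable.and (hlt _ (by fun_prop) _)
      (Measurable.imp (Measurable.not ?_) (hlt _ (by fun_prop) _)))
    (Measurable.and (hlt _ (by fun_prop) _) (hlt _ (by fun_prop) _)))
  exact measurableSet_setOfPred.1 (measurableSet_eq_fun (by fun_prop) measurable_const)

theorem measurableSet_injective_time :
    MeasurableSet {θ : Param p | Function.Injective θ.time} := by
  refine measurableSet_setOfPred.2 (Measurable.forall fun i => Measurable.forall fun j =>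
    Measurable.imp ?_ measurable_const)
  exact measurableSet_setOfPred.1 (measurableSet_eq_fun (by fun_prop) (by fun_prop))

theorem mem_cell_of_dist_lt {q θ : Param p} {r : ℝ} (h : dist θ q < r) : θ ∈ cell q r := by
  simp only [Prod.dist_eq, sup_lt_iff] at h
  obtain ⟨hb, ht, ha, hv⟩ := h
  exact ⟨1, fun j => ⟨(dist_le_pi_dist θ.coef q.coef j).trans_lt hb,
    fun _ => (dist_le_pi_dist θ.time q.time j).trans_lt ht⟩, ha, hv⟩

/-- A small cell around a point near `θ₀` lies in `activeBallUpToPerm θ₀ ε`. The bound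
`2 * r < |θ₀.coef j|` ensures that a component active in `θ₀` is active all over the cell. -/
theorem cell_subset_activeBallUpToPerm {q θ₀ : Param p} {r ε : ℝ} (hq : dist θ₀ q < r)
    (hr : (2 * p + 2) * (2 * r) < ε) (hcoef : ∀ j, θ₀.coef j ≠ 0 → 2 * r < |θ₀.coef j|) :
    cell q r ⊆ θ₀.activeBallUpToPerm ε := by
  simp only [Prod.dist_eq, sup_lt_iff] at hq
  obtain ⟨hb, ht, ha, hv⟩ := hq
  have hr0 : 0 < r := dist_nonneg.trans_lt ha
  have hb' : ∀ j, |θ₀.coef j - q.coef j| < r := fun j =>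
    (dist_le_pi_dist θ₀.coef q.coef j).trans_lt hb
  have ht' : ∀ j, |(θ₀.time j : ℝ) - q.time j| < r := fun j =>
    (dist_le_pi_dist θ₀.time q.time j).trans_lt ht
  have htri : ∀ {a b c : ℝ}, |a - c| < r → |b - c| < r → |a - b| < 2 * r := by
    intro a b c h1 h2
    rw [abs_lt] at *
    constructor <;> linarith
  have hsq : ∀ {a b : ℝ}, |a - b| < 2 * r → (a - b) ^ 2 ≤ (2 * r) ^ 2 := fun {a b} h =>
    sq_le_sq' (abs_lt.1 h).1.le (abs_lt.1 h).2.le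
  rintro θ ⟨ν, hν, hνa, hνv⟩
  refine Set.mem_iUnion.2 ⟨ν, show min _ _ < ε from min_lt_of_left_lt ?_⟩
  have hε : 0 < ε := lt_trans (by positivity) hr
  rw [Param.activeDist, Real.sqrt_lt' hε]
  have h1 : ∀ j, (θ.coef j - (θ₀.relabel ν).coef j) ^ 2 ≤ (2 * r) ^ 2 := fun j =>
    hsq (htri (hν j).1 (hb' (ν j)))
  have h2 : ∀ j, (if (θ₀.relabel ν).coef j = 0 then 0
      else ((θ.time j : ℝ) - (θ₀.relabel ν).time j) ^ 2) ≤ (2 * r) ^ 2 := by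
    intro j
    split_ifs with h0
    · positivity
    · refine hsq (htri ((hν j).2 fun hz => ?_) (ht' (ν j)))
      have h3 : |θ.coef j - θ₀.coef (ν j)| < 2 * r := htri (hν j).1 (hb' (ν j))
      rw [hz, zero_sub, abs_neg] at h3
      exact lt_asymm h3 (hcoef (ν j) h0)
  have h3 : (θ.icpt - (θ₀.relabel ν).icpt) ^ 2 ≤ (2 * r) ^ 2 := hsq (htri hνa ha)
  have h4 : ((θ.var : ℝ) - (θ₀.relabel ν).var) ^ 2 ≤ (2 * r) ^ 2 := hsq (htri hνv hv)
  have h5 := Finset.sum_le_sum fun j (_ : j ∈ Finset.univ) => h1 j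
  have h6 := Finset.sum_le_sum fun j (_ : j ∈ Finset.univ) => h2 j
  simp only [Finset.sum_const, Finset.card_univ, Fintype.card_fin, nsmul_eq_mul] at h5 h6
  have hp : (0 : ℝ) ≤ p := p.cast_nonneg
  calc _ ≤ (2 * p + 2) * (2 * r) ^ 2 := by linarith
    _ ≤ ((2 * p + 2) * (2 * r)) ^ 2 := by
      rw [mul_pow (2 * (p : ℝ) + 2)]
      exact mul_le_mul_of_nonneg_right (le_self_pow₀ (by linarith) two_ne_zero) (sq_nonneg _)
    _ < ε ^ 2 := pow_lt_pow_left₀ hr (by positivity) two_ne_zero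

theorem activeBallUpToPerm_eq_ballUpToPerm {θ₀ : Param p} (h : ∀ j, θ₀.coef j ≠ 0) (ε : ℝ) :
    θ₀.activeBallUpToPerm ε = θ₀.ballUpToPerm ε := by
  have h' : ∀ (ν : Equiv.Perm (Fin p)) j, (θ₀.relabel ν).coef j ≠ 0 := fun ν j => h (ν j)
  simp [Param.activeBallUpToPerm, Param.ballUpToPerm, Param.d, Param.eucDist, Param.activeDist, h']

/-- Membership in a cell is a property of the moments of `testStat`. -/
theorem mem_cell_of_moments {Ω : Type*} [MeasurableSpace Ω] {X : unitInterval → Ω → ℝ}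
    {Q : Measure Ω} [IsProbabilityMeasure Q] (hX : IsRegressor X Q) {θ θ' : Param p}
    (hθ : Function.Injective θ.time) (hθ' : Function.Injective θ'.time)
    (h : ∀ k, ∫ x, testStat k x ∂(dataLaw hX θ) = ∫ x, testStat k x ∂(dataLaw hX θ'))
    {q : Param p} {r : ℝ} (hmem : θ ∈ cell q r) : θ' ∈ cell q r := by
  obtain ⟨⟨μ, hμ⟩, ha, hv⟩ := exists_perm_of_moments hX hθ hθ' h
  obtain ⟨ν, hν, hνa, hνv⟩ := hmem
  refine ⟨μ.trans ν, fun j => ⟨?_, fun hj => ?_⟩, by rwa [ha], by rwa [hv]⟩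
  · rw [(hμ j).1]
    exact (hν (μ j)).1
  · rw [(hμ j).2 hj]
    exact (hν (μ j)).2 (by rwa [← (hμ j).1])

end Neighbourhoods

/-! ### Posterior consistency -/

theorem ae_tendsto_posterior_activeBallUpToPerm {Ω : Type*} [MeasurableSpace Ω] {Q : Measure Ω}
    [IsProbabilityMeasure Q] {X : unitInterval → Ω → ℝ} (hX : IsRegressor X Q) {p : ℕ}
    {prior : Measure (Param p)} [IsProbabilityMeasure prior]
    (htimes : ∀ i j : Fin p, i < j → prior {θ | θ.time i = θ.time j} = 0)
    {post : (n : ℕ) → Kernel (Fin n → Obs) (Param p)}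
    (hpost : ∀ n, IsPosterior hX prior n (post n)) :
    ∀ᵐ θ₀ ∂prior, ∀ ε : ℝ, 0 < ε → ∀ᵐ z ∂(seqLaw hX θ₀),
      Tendsto (fun n => post n (firstObs n z) (θ₀.activeBallUpToPerm ε)) atTop (𝓝 1) := by
  have hmarkov : ∀ n, IsMarkovKernel (post n) := fun n => (hpost n).1
  have hD : ∀ᵐ θ ∂prior, θ ∈ {θ : Param p | Function.Injective θ.time} := by
    have h : ∀ᵐ θ ∂prior, ∀ i j : Fin p, i < j → θ.time i ≠ θ.time j := by
      simp only [ae_all_iff]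
      exact fun i j hij => measure_eq_zero_iff_ae_notMem.1 (htimes i j hij)
    filter_upwards [h] with θ hθ i j hij
    by_contra hne
    rcases lt_or_gt_of_ne hne with hlt | hlt
    · exact hθ i j hlt hij
    · exact hθ j i hlt hij.symm
  let P : Kernel (Param p) Obs := ⟨dataLaw hX, measurable_dataLaw hX⟩
  have : IsMarkovKernel P := ⟨fun θ => isProbabilityMeasure_dataLaw hX θ⟩
  -- Countably many cells suffice, so that one null set of parameters serves them all.
  have hcells : ∀ᵐ θ ∂prior, ∀ m k : ℕ,
      θ ∈ cell (TopologicalSpace.denseSeq (Param p) m) (1 / ((k : ℝ) + 1)) →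
      ∀ᵐ z ∂(seqLaw hX θ), Tendsto (fun n => post n (firstObs n z)
        (cell (TopologicalSpace.denseSeq (Param p) m) (1 / ((k : ℝ) + 1)))) atTop (𝓝 1) := by
    simp only [ae_all_iff]
    exact fun m k => ae_tendsto_posterior_of_moments (P := P) (η := seqKernel hX p)
      (fun θ => rfl) hmarkov (fun n => (hpost n).2) measurable_testStat
      (fun k θ => integrable_testStat hX θ k) measurableSet_injective_time hD
      (measurableSet_cell _ _) fun θ hθ θ' hθ' h => mem_cell_of_moments hX hθ hθ' h
  filter_upwards [hcells] with θ₀ hθ₀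
  intro ε hε
  have hlim : Tendsto (fun k : ℕ => 2 * (1 / ((k : ℝ) + 1))) atTop (𝓝 0) := by
    simpa using tendsto_one_div_add_atTop_nhds_zero_nat.const_mul (2 : ℝ)
  have hlim' : Tendsto (fun k : ℕ => (2 * (p : ℝ) + 2) * (2 * (1 / ((k : ℝ) + 1)))) atTop
      (𝓝 0) := by
    simpa using hlim.const_mul (2 * (p : ℝ) + 2)
  have hcoef : ∀ᶠ k : ℕ in atTop, ∀ j, θ₀.coef j ≠ 0 →
      2 * (1 / ((k : ℝ) + 1)) < |θ₀.coef j| := by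
    refine eventually_all.2 fun j => ?_
    by_cases hj : θ₀.coef j = 0
    · simp [hj]
    · filter_upwards [hlim.eventually_lt_const (abs_pos.2 hj)] with k hk _ using hk
  obtain ⟨k, hk, hkε⟩ := (hcoef.and (hlim'.eventually_lt_const hε)).exists
  obtain ⟨m, hm⟩ := (TopologicalSpace.denseRange_denseSeq (Param p)).exists_dist_lt θ₀
    (Nat.one_div_pos_of_nat (α := ℝ) (n := k))
  have hsub := cell_subset_activeBallUpToPerm hm hkε hk
  filter_upwards [hθ₀ m k (mem_cell_of_dist_lt hm)] with z hz
  exact tendsto_of_tendsto_of_tendsto_of_le_of_le hz tendsto_const_nhds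
    (fun n => measure_mono hsub) fun n => prob_le_one

end FunctionalRegression

theorem corollary1 {Ω : Type*} [MeasurableSpace Ω] (Q : Measure Ω) [IsProbabilityMeasure Q]
    (X : unitInterval → Ω → ℝ) (hX : FunctionalRegression.IsRegressor X Q)
    (p : ℕ) (prior : Measure (FunctionalRegression.Param p)) [IsProbabilityMeasure prior]
    (htimes : ∀ i j : Fin p, i < j → prior {θ | θ.time i = θ.time j} = 0)
    (post : (n : ℕ) → Kernel (Fin n → FunctionalRegression.Obs) (FunctionalRegression.Param p))
    (hpost : ∀ n, FunctionalRegression.IsPosterior hX prior n (post n)) :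
    ∀ᵐ θ₀ ∂prior,
      ((∀ j, θ₀.coef j ≠ 0) → ∀ ε : ℝ, 0 < ε →
        ∀ᵐ z ∂(FunctionalRegression.seqLaw hX θ₀),
          Tendsto (fun n => post n (FunctionalRegression.firstObs n z) (θ₀.ballUpToPerm ε))
            atTop (𝓝 1)) ∧
      (∀ ε : ℝ, 0 < ε →
        ∀ᵐ z ∂(FunctionalRegression.seqLaw hX θ₀),
          Tendsto (fun n => post n (FunctionalRegression.firstObs n z) (θ₀.activeBallUpToPerm ε))
            atTop (𝓝 1)) := by
  filter_upwards [FunctionalRegression.ae_tendsto_posterior_activeBallUpToPerm hX htimes hpost]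
    with θ₀ hθ₀
  refine ⟨fun h ε hε => ?_, hθ₀⟩
  rw [← FunctionalRegression.activeBallUpToPerm_eq_ballUpToPerm h]
  exact hθ₀ ε hε
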